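/- Let $n\ge 1$ and let $A=[a_{ij}]\in\mathbb C^{n\times n}$ have zero diagonal. Let $\mathcal G(A)$ be the digraph on $\{1,\dots,n\}$ with an edge from $j$ to $i$ if and only if $a_{ij}\ne 0$; it is said to have a spanning tree if some vertex has a directed path to every other vertex. Put $d_i=\sum_{j}|a_{ij}|$, $\Delta=\max_i d_i$ (the maximum modulus degree) and $L=\mathrm{diag}(d_1,\dots,d_n)-A$. Let $\mathbb T=\{w\in\mathbb C:|w|=1\}$ and, for $\zeta\in\mathbb T^n$, $D_\zeta=\mathrm{diag}(\zeta)$. The matrix $A$ is called essentially nonnegative if there is $\zeta\in\mathbb T^n$ such that all entries of $D_\zeta^{-1}AD_\zeta$ are real and nonnegative. Let $0<\kappa<1/\Delta$ (with $1/\Delta=+\infty$ if $\Delta=0$) and consider the discrete-time system $$z(k+1)=z(k)-\kappa Lz(k),\qquad k=0,1,2,\dots,\quad z(k)\in\mathbb C^n .$$ It is said to reach complex consensus if for almost every initial state $z(0)\in\mathbb C^n$ (with respect to Lebesgue measure) there is a number $a>0$ such that $\lim_{k\to\infty}|z_i(k)|=a$ for all $i=1,\dots,n$. Then the system reaches complex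 consensus if and only if $A$ is essentially nonnegative and $\mathcal G(A)$ has a spanning tree. In this case there are a vector $\zeta\in\mathbb T^n$ with $L\zeta=0$ and a real vector $\nu\in\mathbb R^n$ with $\nu_i\ge 0$ for all $i$, $\|\nu\|_1=1$ and $\nu^T D_\zeta^{-1}LD_\zeta=0$; and for every such pair $(\zeta,\nu)$, with $\eta=D_\zeta^{-1}\nu$, every solution with arbitrary initial state $z(0)\in\mathbb C^n$ satisfies $$\lim_{k\to\infty}z(k)=(\eta^Tz(0))\,\zeta .$$ -/

import Mathlib

open Filter Topology MeasureTheory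

namespace ComplexConsensus

noncomputable section

/-- The digraph of a complex matrix `A`: there is an edge from `j` to `i` iff `A i j ≠ 0`. -/
def graph {n : ℕ} (A : Matrix (Fin n) (Fin n) ℂ) : Digraph (Fin n) where
  Adj j i := A i j ≠ 0

/-- A digraph has a (directed) spanning tree if some vertex, the root, has a directed path to
every vertex (the path of length zero leads from the root to itself). -/
def HasSpanningTree {V : Type*} (G : Digraph V) : Prop :=
  ∃ r : V, ∀ v : V, Relation.ReflTransGen G.Adj r v

/-- The modulus degree `d_i`, the sum of `|a_ij|` over the neighbours `j` of `i`, i.e. over the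
`j` with `a_ij ≠ 0`; the remaining terms vanish. -/
def modulusDegree {n : ℕ} (A : Matrix (Fin n) (Fin n) ℂ) (i : Fin n) : ℝ :=
  ∑ j, ‖A i j‖

/-- The maximum modulus degree `Δ`. -/
def maxModulusDegree {n : ℕ} [NeZero n] (A : Matrix (Fin n) (Fin n) ℂ) : ℝ :=
  Finset.univ.sup' Finset.univ_nonempty (modulusDegree A)

/-- The complex Laplacian `L = D - A`, with `D` the diagonal matrix of modulus degrees. -/
def laplacian {n : ℕ} (A : Matrix (Fin n) (Fin n) ℂ) : Matrix (Fin n) (Fin n) ℂ :=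
  Matrix.diagonal (fun i => (modulusDegree A i : ℂ)) - A

/-- The diagonal matrix `D_ζ` of a vector `ζ` with entries on the unit circle. -/
def circleDiag {n : ℕ} (ζ : Fin n → Circle) : Matrix (Fin n) (Fin n) ℂ :=
  Matrix.diagonal (fun i => (ζ i : ℂ))

/-- Switching equivalence of the graphs of `A₁` and `A₂`. -/
def SwitchingEquivalent {n : ℕ} (A₁ A₂ : Matrix (Fin n) (Fin n) ℂ) : Prop :=
  ∃ ζ : Fin n → Circle, A₂ = (circleDiag ζ)⁻¹ * A₁ * circleDiag ζ

/-- All entries are real and nonnegative. -/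
def IsNonnegative {n : ℕ} (A : Matrix (Fin n) (Fin n) ℂ) : Prop :=
  ∀ i j, 0 ≤ (A i j).re ∧ (A i j).im = 0

/-- `A` is essentially nonnegative if its graph is switching equivalent to a graph with a
nonnegative adjacency matrix. -/
def EssentiallyNonnegative {n : ℕ} (A : Matrix (Fin n) (Fin n) ℂ) : Prop :=
  ∃ A₁ : Matrix (Fin n) (Fin n) ℂ, SwitchingEquivalent A A₁ ∧ IsNonnegative A₁

/-- `z` is a trajectory of the discrete-time system `z(k+1) = z(k) - κ L z(k)`. -/
def IsTrajectory {n : ℕ} (A : Matrix (Fin n) (Fin n) ℂ) (κ : ℝ) (z : ℕ → Fin n → ℂ) : Prop :=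
  ∀ k, z (k + 1) = z k - (κ : ℂ) • (laplacian A).mulVec (z k)

/-- The discrete-time system reaches complex consensus: for almost every initial state (with
respect to Lebesgue measure on `ℂⁿ`) the moduli of all agents converge to one common positive
number. The exceptional null set is indispensable: the trajectory of the initial state `0`
is `0`, for every system. -/
def ReachesComplexConsensus {n : ℕ} (A : Matrix (Fin n) (Fin n) ℂ) (κ : ℝ) : Prop :=
  ∀ᵐ z₀ : Fin n → ℂ, ∀ z : ℕ → Fin n → ℂ, IsTrajectory A κ z → z 0 = z₀ →
    ∃ a : ℝ, 0 < a ∧ ∀ i, Tendsto (fun k => ‖z k i‖) atTop (𝓝 a)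

/-- `ζ ∈ 𝕋ⁿ` is an eigenvector of the Laplacian for the eigenvalue zero. -/
def IsCircleNullVector {n : ℕ} (A : Matrix (Fin n) (Fin n) ℂ) (ζ : Fin n → Circle) : Prop :=
  (laplacian A).mulVec (fun i => (ζ i : ℂ)) = 0

/-- `ν` is a nonnegative left eigenvector of `D_ζ⁻¹ L D_ζ` for the eigenvalue zero, with
`1`-norm one. -/
def IsNormalizedLeftNullVector {n : ℕ} (A : Matrix (Fin n) (Fin n) ℂ) (ζ : Fin n → Circle)
    (ν : Fin n → ℝ) : Prop :=
  (∀ i, 0 ≤ ν i) ∧ ∑ i, |ν i| = 1 ∧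
    Matrix.vecMul (fun i => (ν i : ℂ)) ((circleDiag ζ)⁻¹ * laplacian A * circleDiag ζ) = 0

/-- The vector `η = D_ζ⁻¹ ν`. -/
def leftVector {n : ℕ} (ζ : Fin n → Circle) (ν : Fin n → ℝ) : Fin n → ℂ :=
  (circleDiag ζ)⁻¹.mulVec (fun i => (ν i : ℂ))

end

end ComplexConsensus

/-! Call `ζ` aligned if switching by `ζ` replaces every `a_ij` by `|a_ij|`. In the coordinates `y =
D_ζ⁻¹ z` the system is then `y(k+1) = P y(k)`, with `P` real, row stochastic and, since `κΔ < 1`, of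
positive diagonal. A spanning tree gives some power of `P` a positive column, so the diameter of the
points `y_i` decays geometrically (`tendsto_sub_of_reachable`). A stationary vector `ν` of `P` makes
`νᵀy` a conserved quantity, which identifies the limit (`tendsto_stationary`); its modulus is
nonzero off a proper subspace.

Conversely, a limit point of a consensus trajectory and its image under `1 - κL` both have all
entries of the same positive modulus. Equality in the triangle inequality then forces alignment
(`exists_isAligned_of_norm_eq`). Without a spanning tree, two vertices have disjoint ancestor sets;
these evolve independently and keep distinct moduli for an open set of initial states. -/

namespace ComplexConsensus

/-! ### Row stochastic matrices -/

section Stochastic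

variable {ι E : Type*} [Fintype ι] [DecidableEq ι] [NormedAddCommGroup E] [NormedSpace ℝ E]
  {P : Matrix ι ι ℝ}

/-- A row stochastic matrix with a positive diagonal has a power with a positive column at any
vertex from which all vertices can be reached. -/
theorem exists_pow_col_pos (hP : P ∈ Matrix.rowStochastic ℝ ι) (hdiag : ∀ i, 0 < P i i) {r : ι}
    (hr : ∀ v, Relation.ReflTransGen (fun j i => 0 < P i j) r v) :
    ∃ m, ∀ v, 0 < (P ^ m) v r := by
  have hnn : ∀ m i j, 0 ≤ (P ^ m) i j := fun m i j => (pow_mem hP m).1 i j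
  have hstep : ∀ m v u, 0 < P v u → 0 < (P ^ m) u r → 0 < (P ^ (m + 1)) v r := by
    intro m v u h₁ h₂
    rw [pow_succ', Matrix.mul_apply]
    exact (mul_pos h₁ h₂).trans_le (Finset.single_le_sum
      (f := fun j => P v j * (P ^ m) j r) (fun j _ => mul_nonneg (hP.1 v j) (hnn m j r))
      (Finset.mem_univ u))
  -- The positive diagonal makes positivity persist as `m` grows, so one exponent serves all `v`.
  have hev : ∀ v, ∀ᶠ m in atTop, 0 < (P ^ m) v r := by
    intro v
    suffices h : ∃ m, 0 < (P ^ m) v r by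
      obtain ⟨m, hm⟩ := h
      filter_upwards [eventually_ge_atTop m] with k hk
      induction k, hk using Nat.le_induction with
      | base => exact hm
      | succ k _ ih => exact hstep k v v (hdiag v) ih
    induction hr v with
    | refl => exact ⟨0, by simp⟩
    | tail _ h ih =>
      obtain ⟨m, hm⟩ := ih
      exact ⟨m + 1, hstep m _ _ h hm⟩
  exact (eventually_all.2 hev).exists

/-- Two weighted averages with weights of the same total mass `s > 0` differ by at most `s` times
the diameter of the averaged points. -/
theorem norm_sum_smul_sub_sum_smul_le {ι : Type*} [Fintype ι] {p q : ι → ℝ} {s C : ℝ}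
    (hp : ∀ i, 0 ≤ p i)
    (hq : ∀ i, 0 ≤ q i) (hps : ∑ i, p i = s) (hqs : ∑ i, q i = s) (hs : 0 < s) {y : ι → E}
    (hy : ∀ i j, ‖y i - y j‖ ≤ C) : ‖∑ i, p i • y i - ∑ i, q i • y i‖ ≤ s * C := by
  -- Each average is expanded against the weights of the other, so that only differences of points
  -- remain.
  have key : s • (∑ i, p i • y i - ∑ i, q i • y i) =
      ∑ i, ∑ j, (p i * q j) • (y i - y j) := by
    simp only [smul_sub, Finset.sum_sub_distrib]
    congr 1
    · rw [Finset.smul_sum]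
      refine Finset.sum_congr rfl fun i _ => ?_
      rw [← Finset.sum_smul, ← Finset.mul_sum, hqs, smul_smul, mul_comm]
    · rw [Finset.sum_comm, Finset.smul_sum]
      refine Finset.sum_congr rfl fun j _ => ?_
      rw [← Finset.sum_smul, ← Finset.sum_mul, hps, smul_smul]
  have hb : ‖s • (∑ i, p i • y i - ∑ i, q i • y i)‖ ≤ s * (s * C) := by
    rw [key]
    calc _ ≤ ∑ i, ∑ j, p i * q j * C := by
          refine (norm_sum_le _ _).trans (Finset.sum_le_sum fun i _ => ?_)
          refine (norm_sum_le _ _).trans (Finset.sum_le_sum fun j _ => ?_)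
          have h0 := mul_nonneg (hp i) (hq j)
          rw [norm_smul, Real.norm_of_nonneg h0]
          exact mul_le_mul_of_nonneg_left (hy i j) h0
      _ = s * (s * C) := by
          simp only [← Finset.sum_mul, ← Finset.mul_sum, hqs, hps, mul_assoc]
  rw [norm_smul, Real.norm_of_nonneg hs.le] at hb
  exact le_of_mul_le_mul_left hb hs

/-- All rows share mass `ε` at `r`. Its contribution cancels in the difference, leaving nonnegative
weights of total `1 - ε`. -/
theorem norm_mul_sub_mul_le {Q : Matrix ι ι ℝ} (hQ : Q ∈ Matrix.rowStochastic ℝ ι) {r : ι} {ε : ℝ}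
    (hε : ε < 1) (hcol : ∀ i, ε ≤ Q i r) {C : ℝ} {y : ι → E} (hy : ∀ i j, ‖y i - y j‖ ≤ C)
    (i j : ι) : ‖∑ l, Q i l • y l - ∑ l, Q j l • y l‖ ≤ (1 - ε) * C := by
  have hsum : ∀ i, ∑ l, (Q i l - Pi.single (M := fun _ => ℝ) r ε l) = 1 - ε := fun i => by
    rw [Finset.sum_sub_distrib, Matrix.sum_row_of_mem_rowStochastic hQ, Finset.sum_pi_single']
    simp
  have hnn : ∀ i l, 0 ≤ Q i l - Pi.single (M := fun _ => ℝ) r ε l := by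
    intro i l
    rcases eq_or_ne l r with rfl | h
    · simpa using hcol i
    · simpa [h] using hQ.1 i l
  have := norm_sum_smul_sub_sum_smul_le (hnn i) (hnn j) (hsum i) (hsum j) (by linarith) hy
  simpa only [sub_smul, Finset.sum_sub_distrib, sub_sub_sub_cancel_right] using this

theorem iterate_eq_pow_smul {y : ℕ → ι → E} (hy : ∀ k i, y (k + 1) i = ∑ j, P i j • y k j)
    (k m : ℕ) (i : ι) : y (k + m) i = ∑ j, (P ^ m) i j • y k j := by
  induction m generalizing i with
  | zero => simp [Matrix.one_apply]
  | succ m ih =>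
    rw [← add_assoc, hy, pow_succ']
    simp only [ih, Matrix.mul_apply, Finset.smul_sum, Finset.sum_smul, smul_smul]
    exact Finset.sum_comm

/-- The iterates of a row stochastic matrix with a positive diagonal and a rooted graph
contract to the diagonal. -/
theorem tendsto_sub_of_reachable (hP : P ∈ Matrix.rowStochastic ℝ ι) (hdiag : ∀ i, 0 < P i i)
    {r : ι} (hr : ∀ v, Relation.ReflTransGen (fun j i => 0 < P i j) r v) {y : ℕ → ι → E}
    (hy : ∀ k i, y (k + 1) i = ∑ j, P i j • y k j) (i j : ι) :
    Tendsto (fun k => y k i - y k j) atTop (𝓝 0) := by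
  obtain ⟨m, hm⟩ := exists_pow_col_pos hP hdiag hr
  obtain ⟨ε, hε0, hε1, hε⟩ : ∃ ε : ℝ, 0 < ε ∧ ε < 1 ∧ ∀ i, ε ≤ (P ^ m) i r := by
    have : Nonempty ι := ⟨r⟩
    obtain ⟨i₀, hi₀⟩ := Finite.exists_min fun i => (P ^ m) i r
    have h1 := Matrix.le_one_of_mem_rowStochastic (pow_mem hP m) (i := i₀) (j := r)
    have h0 := hm i₀
    -- Halving keeps `ε < 1` even if the minimal entry is `1`.
    exact ⟨(P ^ m) i₀ r / 2, by linarith, by linarith, fun i => by linarith [hi₀ i]⟩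
  obtain ⟨C, hC⟩ : ∃ C, ∀ i j, ‖y 0 i - y 0 j‖ ≤ C := by
    refine ⟨∑ i, ∑ j, ‖y 0 i - y 0 j‖, fun i j => ?_⟩
    exact (Finset.single_le_sum (f := fun j => ‖y 0 i - y 0 j‖) (fun _ _ => norm_nonneg _)
      (Finset.mem_univ j)).trans (Finset.single_le_sum (f := fun i => ∑ j, ‖y 0 i - y 0 j‖)
        (fun _ _ => Finset.sum_nonneg fun _ _ => norm_nonneg _) (Finset.mem_univ i))
  -- The case `ε = 0`: the diameter never grows, which covers the times between multiples of `m`.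
  have hmono : ∀ {k C}, (∀ i j, ‖y k i - y k j‖ ≤ C) →
      ∀ l i j, ‖y (k + l) i - y (k + l) j‖ ≤ C := by
    intro k C h l i j
    rw [iterate_eq_pow_smul hy, iterate_eq_pow_smul hy]
    simpa using norm_mul_sub_mul_le (pow_mem hP l) zero_lt_one
      (fun i => (pow_mem hP l).1 i r) h i j
  have hgeom : ∀ t i j, ‖y (t * m) i - y (t * m) j‖ ≤ (1 - ε) ^ t * C := by
    intro t
    induction t with
    | zero => simpa using hC
    | succ t ih =>
      intro i j
      rw [add_mul, one_mul, iterate_eq_pow_smul hy, iterate_eq_pow_smul hy, pow_succ', mul_assoc]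
      exact norm_mul_sub_mul_le (pow_mem hP m) hε1 hε ih i j
  have hlim : Tendsto (fun t : ℕ => (1 - ε) ^ t * C) atTop (𝓝 0) := by
    simpa using (tendsto_pow_atTop_nhds_zero_of_lt_one (by linarith)
      (by linarith : 1 - ε < 1)).mul_const C
  rw [Metric.tendsto_atTop]
  intro δ hδ
  obtain ⟨t, ht⟩ := (hlim.eventually_lt_const hδ).exists
  refine ⟨t * m, fun k hk => ?_⟩
  obtain ⟨l, rfl⟩ := Nat.exists_eq_add_of_le hk
  rw [dist_zero_right]
  exact (hmono (hgeom t) l i j).trans_lt ht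

/-- A stationary distribution picks out the limit of the iterates. -/
theorem tendsto_stationary (hP : P ∈ Matrix.rowStochastic ℝ ι) (hdiag : ∀ i, 0 < P i i)
    {r : ι} (hr : ∀ v, Relation.ReflTransGen (fun j i => 0 < P i j) r v) {y : ℕ → ι → E}
    (hy : ∀ k i, y (k + 1) i = ∑ j, P i j • y k j) {ν : ι → ℝ} (hν1 : ∑ i, ν i = 1)
    (hν : ∀ j, ∑ i, ν i * P i j = ν j) (i : ι) :
    Tendsto (fun k => y k i) atTop (𝓝 (∑ j, ν j • y 0 j)) := by
  have hconst : ∀ k, ∑ j, ν j • y k j = ∑ j, ν j • y 0 j := by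
    intro k
    induction k with
    | zero => rfl
    | succ k ih =>
      rw [← ih]
      simp only [hy, Finset.smul_sum, smul_smul]
      rw [Finset.sum_comm]
      simp only [← Finset.sum_smul, hν]
  have h := tendsto_finsetSum Finset.univ fun j (_ : j ∈ Finset.univ) =>
    (tendsto_sub_of_reachable hP hdiag hr hy i j).const_smul (ν j)
  simp only [smul_zero, Finset.sum_const_zero, smul_sub, Finset.sum_sub_distrib, hconst,
    ← Finset.sum_smul, hν1, one_smul] at h
  simpa using h.add_const (∑ j, ν j • y 0 j)

/-- Since `P` fixes the vector `1`, it has a left fixed vector `v`. Then `|v| ≤ |v|P` entrywise, and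
both sides have the same total because rows sum to one. Hence `|v|` is fixed and can be normalised.
-/
theorem exists_stationary [Nonempty ι] (hP : P ∈ Matrix.rowStochastic ℝ ι) :
    ∃ ν : ι → ℝ, (∀ i, 0 ≤ ν i) ∧ ∑ i, ν i = 1 ∧ ∀ j, ∑ i, ν i * P i j = ν j := by
  have hdet : (P - 1).det = 0 := by
    refine Matrix.exists_mulVec_eq_zero_iff.1 ⟨1, one_ne_zero, ?_⟩
    rw [Matrix.sub_mulVec, hP.2, Matrix.one_mulVec, sub_self]
  obtain ⟨v, hv0, hv⟩ := Matrix.exists_vecMul_eq_zero_iff.2 hdet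
  rw [Matrix.vecMul_sub, Matrix.vecMul_one, sub_eq_zero] at hv
  have hle : ∀ j, |v j| ≤ ∑ i, |v i| * P i j := by
    intro j
    calc |v j| = |∑ i, v i * P i j| := by
          conv_lhs => rw [← hv]
          rfl
      _ ≤ ∑ i, |v i| * P i j := (Finset.abs_sum_le_sum_abs _ _).trans_eq
          (Finset.sum_congr rfl fun i _ => by rw [abs_mul, abs_of_nonneg (hP.1 i j)])
  have htot : ∑ j, |v j| = ∑ j, ∑ i, |v i| * P i j := by
    rw [Finset.sum_comm]
    simp only [← Finset.mul_sum, Matrix.sum_row_of_mem_rowStochastic hP, mul_one]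
  have heq := (Finset.sum_eq_sum_iff_of_le fun j _ => hle j).1 htot
  have hpos : 0 < ∑ j, |v j| := by
    obtain ⟨i, hi⟩ := Function.ne_iff.1 hv0
    exact Finset.sum_pos' (fun _ _ => abs_nonneg _) ⟨i, Finset.mem_univ i, abs_pos.2 hi⟩
  refine ⟨fun i => |v i| / ∑ j, |v j|, fun i => by positivity, ?_, fun j => ?_⟩
  · rw [← Finset.sum_div, div_self hpos.ne']
  · simp only [div_mul_eq_mul_div]
    rw [← Finset.sum_div, ← heq j (Finset.mem_univ j)]

/-- Points indexed by a predecessor-closed set stay in any ball that contains them initially. -/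
theorem norm_sub_le_of_predecessor_closed (hP : P ∈ Matrix.rowStochastic ℝ ι) {S : Set ι}
    (hS : ∀ i ∈ S, ∀ j, P i j ≠ 0 → j ∈ S) {y : ℕ → ι → E}
    (hy : ∀ k i, y (k + 1) i = ∑ j, P i j • y k j) {c : E} {ρ : ℝ}
    (h0 : ∀ i ∈ S, ‖y 0 i - c‖ ≤ ρ) (k : ℕ) : ∀ i ∈ S, ‖y k i - c‖ ≤ ρ := by
  induction k with
  | zero => exact h0
  | succ k ih =>
    intro i hi
    have hsum := Matrix.sum_row_of_mem_rowStochastic hP i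
    have : y (k + 1) i - c = ∑ j, P i j • (y k j - c) := by
      simp only [smul_sub, Finset.sum_sub_distrib, ← Finset.sum_smul, hsum, one_smul, hy]
    rw [this]
    calc _ ≤ ∑ j, P i j * ρ := by
          refine (norm_sum_le _ _).trans (Finset.sum_le_sum fun j _ => ?_)
          rw [norm_smul, Real.norm_of_nonneg (hP.1 i j)]
          by_cases h : P i j = 0
          · simp [h]
          · exact mul_le_mul_of_nonneg_left (ih j (hS i hi j h)) (hP.1 i j)
      _ = ρ := by rw [← Finset.sum_mul, hsum, one_mul]

end Stochastic

/-! ### Digraphs without a spanning tree -/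

/-- In a nonempty finite digraph without a spanning tree there are two vertices without a common
ancestor. -/
theorem exists_disjoint_ancestors {V : Type*} [Finite V] [Nonempty V] {G : Digraph V}
    (h : ¬ HasSpanningTree G) : ∃ v w : V, ∀ u, Relation.ReflTransGen G.Adj u v →
      ¬ Relation.ReflTransGen G.Adj u w := by
  let anc : V → Set V := fun v => {u | Relation.ReflTransGen G.Adj u v}
  -- With `v` having the fewest ancestors, any ancestor `u` of `v` has the same ancestors as `v`, so
  -- `v` reaches `u` and everything that `u` reaches.
  obtain ⟨v, hv⟩ := Finite.exists_min fun v => (anc v).ncard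
  obtain ⟨w, hw⟩ : ∃ w, ¬ Relation.ReflTransGen G.Adj v w := by
    by_contra! hc
    exact h ⟨v, hc⟩
  refine ⟨v, w, fun u huv huw => hw ?_⟩
  have hsub : anc u ⊆ anc v := fun x hx => Relation.ReflTransGen.trans hx huv
  have heq : anc u = anc v := Set.eq_of_subset_of_ncard_le hsub (hv u)
  have hvu : v ∈ anc u := heq ▸ (Relation.ReflTransGen.refl : v ∈ anc v)
  exact Relation.ReflTransGen.trans hvu huw

/-! ### Gauges that make the adjacency matrix nonnegative -/

section Gauge

open scoped ComplexOrder

variable {n : ℕ} {A : Matrix (Fin n) (Fin n) ℂ} {ζ : Fin n → Circle}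

theorem circleDiag_inv (ζ : Fin n → Circle) : (circleDiag ζ)⁻¹ = circleDiag ζ⁻¹ := by
  refine Matrix.inv_eq_left_inv ?_
  simp [circleDiag, Matrix.diagonal_mul_diagonal]

theorem circleDiag_conj_apply (M : Matrix (Fin n) (Fin n) ℂ) (ζ : Fin n → Circle) (i j : Fin n) :
    ((circleDiag ζ)⁻¹ * M * circleDiag ζ) i j = (ζ i : ℂ)⁻¹ * M i j * ζ j := by
  rw [circleDiag_inv, circleDiag, circleDiag, Matrix.mul_diagonal, Matrix.diagonal_mul]
  simp

theorem leftVector_apply (ζ : Fin n → Circle) (ν : Fin n → ℝ) (i : Fin n) :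
    leftVector ζ ν i = (ζ i : ℂ)⁻¹ * ν i := by
  rw [leftVector, circleDiag_inv, circleDiag, Matrix.mulVec_diagonal]
  simp

/-- The switching by `ζ` turns every entry of `A` into its modulus. -/
def IsAligned (A : Matrix (Fin n) (Fin n) ℂ) (ζ : Fin n → Circle) : Prop :=
  ∀ i j, A i j * ζ j = ‖A i j‖ * ζ i

theorem eq_norm_of_sum_eq_sum_norm {ι : Type*} [Fintype ι] {t : ι → ℂ}
    (h : ∑ i, t i = ((∑ i, ‖t i‖ : ℝ) : ℂ)) (i : ι) : t i = ‖t i‖ := by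
  have hre : ∑ i, (t i).re = ∑ i, ‖t i‖ := by
    simpa using congrArg Complex.re h
  have heq := (Finset.sum_eq_sum_iff_of_le fun j _ => Complex.re_le_norm (t j)).1 hre i
    (Finset.mem_univ i)
  have h0 := Complex.re_eq_norm.1 heq
  rw [← heq]
  exact Complex.ext (by simp) (by simp [← (Complex.nonneg_iff.1 h0).2])

theorem essentiallyNonnegative_iff_exists_isAligned :
    EssentiallyNonnegative A ↔ ∃ ζ, IsAligned A ζ := by
  constructor
  · rintro ⟨_, ⟨ζ, rfl⟩, h⟩
    refine ⟨ζ, fun i j => ?_⟩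
    obtain ⟨hre, him⟩ := h i j
    rw [circleDiag_conj_apply] at hre him
    have hnn : 0 ≤ (ζ i : ℂ)⁻¹ * A i j * ζ j := Complex.nonneg_iff.2 ⟨hre, him.symm⟩
    have : (ζ i : ℂ)⁻¹ * A i j * ζ j = ‖A i j‖ := by
      rw [Complex.eq_coe_norm_of_nonneg hnn]
      simp [Circle.norm_coe]
    rw [← this]
    field_simp [Circle.coe_ne_zero]
  · rintro ⟨ζ, h⟩
    refine ⟨_, ⟨ζ, rfl⟩, fun i j => ?_⟩
    have : (ζ i : ℂ)⁻¹ * A i j * ζ j = ‖A i j‖ := by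
      rw [mul_assoc, h i j]
      field_simp [Circle.coe_ne_zero]
    rw [circleDiag_conj_apply, this]
    simp

/-- Row `i` of `Lζ = 0` says that the numbers `a_ij ζ_j ζ_i⁻¹` sum to the sum of their moduli: the
equality case of the triangle inequality. -/
theorem isCircleNullVector_iff_isAligned : IsCircleNullVector A ζ ↔ IsAligned A ζ := by
  have hrow : IsCircleNullVector A ζ ↔
      ∀ i, ∑ j, A i j * ζ j = ((∑ j, ‖A i j‖ : ℝ) : ℂ) * ζ i := by
    rw [IsCircleNullVector, laplacian, Matrix.sub_mulVec, sub_eq_zero, funext_iff]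
    refine forall_congr' fun i => ?_
    rw [Matrix.mulVec_diagonal, eq_comm]
    rfl
  rw [hrow]
  constructor
  · intro h i j
    have hsum : ∑ j, A i j * ζ j * (ζ i : ℂ)⁻¹ =
        ((∑ j, ‖A i j * ζ j * (ζ i : ℂ)⁻¹‖ : ℝ) : ℂ) := by
      rw [← Finset.sum_mul, h i, mul_assoc, mul_inv_cancel₀ (Circle.coe_ne_zero _)]
      simp [Circle.norm_coe]
    have := eq_norm_of_sum_eq_sum_norm hsum j
    rw [← div_eq_mul_inv, div_eq_iff (Circle.coe_ne_zero _)] at this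
    simpa [Circle.norm_coe] using this
  · intro h i
    simp only [h i, Finset.sum_mul, Complex.ofReal_sum]

end Gauge

/-! ### The iteration matrix -/

section Iteration

variable {n : ℕ} {A : Matrix (Fin n) (Fin n) ℂ} {κ : ℝ}

/-- The matrix `1 - κ L` of the discrete-time system. -/
noncomputable def stepMatrix (A : Matrix (Fin n) (Fin n) ℂ) (κ : ℝ) : Matrix (Fin n) (Fin n) ℂ :=
  1 - (κ : ℂ) • laplacian A

/-- The iteration matrix of the real system with the weights `|a_ij|`. -/
noncomputable def absStepMatrix (A : Matrix (Fin n) (Fin n) ℂ) (κ : ℝ) : Matrix (Fin n) (Fin n) ℝ :=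
  Matrix.diagonal (fun i => 1 - κ * modulusDegree A i) + κ • A.map (fun w => ‖w‖)

theorem isTrajectory_iff {z : ℕ → Fin n → ℂ} :
    IsTrajectory A κ z ↔ ∀ k, z (k + 1) = (stepMatrix A κ).mulVec (z k) := by
  simp only [IsTrajectory, stepMatrix, Matrix.sub_mulVec, Matrix.one_mulVec, Matrix.smul_mulVec]

theorem exists_isTrajectory (A : Matrix (Fin n) (Fin n) ℂ) (κ : ℝ) (z₀ : Fin n → ℂ) :
    ∃ z, IsTrajectory A κ z ∧ z 0 = z₀ :=
  ⟨fun k => (stepMatrix A κ).mulVec^[k] z₀,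
    isTrajectory_iff.2 fun k => Function.iterate_succ_apply' _ k z₀, rfl⟩

theorem mul_modulusDegree_lt_one [NeZero n] (hκ : 0 < κ)
    (hκΔ : maxModulusDegree A ≠ 0 → κ < 1 / maxModulusDegree A) (i : Fin n) :
    κ * modulusDegree A i < 1 := by
  have hd : 0 ≤ modulusDegree A i := Finset.sum_nonneg fun _ _ => norm_nonneg _
  have hle : modulusDegree A i ≤ maxModulusDegree A :=
    Finset.le_sup' (modulusDegree A) (Finset.mem_univ i)
  by_cases h : maxModulusDegree A = 0
  · rw [h] at hle
    simp [le_antisymm hle hd]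
  · have hpos : 0 < maxModulusDegree A := lt_of_le_of_ne (hd.trans hle) (Ne.symm h)
    exact (mul_le_mul_of_nonneg_left hle hκ.le).trans_lt ((lt_div_iff₀ hpos).1 (hκΔ h))

theorem absStepMatrix_apply_self (hA : ∀ i, A i i = 0) (i : Fin n) :
    absStepMatrix A κ i i = 1 - κ * modulusDegree A i := by
  simp [absStepMatrix, hA]

theorem absStepMatrix_apply_ne {i j : Fin n} (h : i ≠ j) :
    absStepMatrix A κ i j = κ * ‖A i j‖ := by
  simp [absStepMatrix, h]

theorem stepMatrix_apply_self (hA : ∀ i, A i i = 0) (i : Fin n) :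
    stepMatrix A κ i i = (absStepMatrix A κ i i : ℂ) := by
  simp [absStepMatrix_apply_self, stepMatrix, laplacian, hA]

theorem stepMatrix_apply_ne {i j : Fin n} (h : i ≠ j) : stepMatrix A κ i j = κ * A i j := by
  simp [stepMatrix, laplacian, h]

theorem absStepMatrix_mem (hκ : 0 < κ) (hd : ∀ i, κ * modulusDegree A i < 1) :
    absStepMatrix A κ ∈ Matrix.rowStochastic ℝ (Fin n) := by
  refine Matrix.mem_rowStochastic_iff_sum.2 ⟨fun i j => ?_, fun i => ?_⟩
  · simp only [absStepMatrix, Matrix.add_apply, Matrix.smul_apply, Matrix.map_apply, smul_eq_mul,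
      Matrix.diagonal_apply]
    have := hd i
    have : 0 ≤ κ * ‖A i j‖ := by positivity
    split_ifs <;> linarith
  · simp only [absStepMatrix, Matrix.add_apply, Matrix.smul_apply, Matrix.map_apply, smul_eq_mul,
      Matrix.diagonal_apply, Finset.sum_add_distrib, Finset.sum_ite_eq, Finset.mem_univ, if_true,
      ← Finset.mul_sum]
    rw [modulusDegree]
    ring

theorem absStepMatrix_diag_pos (hA : ∀ i, A i i = 0) (hd : ∀ i, κ * modulusDegree A i < 1)
    (i : Fin n) : 0 < absStepMatrix A κ i i := by
  rw [absStepMatrix_apply_self hA]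
  linarith [hd i]

theorem absStepMatrix_pos_of_adj (hA : ∀ i, A i i = 0) (hκ : 0 < κ) {i j : Fin n}
    (h : (graph A).Adj j i) : 0 < absStepMatrix A κ i j := by
  have hij : i ≠ j := by
    rintro rfl
    exact h (hA i)
  rw [absStepMatrix_apply_ne hij]
  exact mul_pos hκ (norm_pos_iff.2 h)

theorem norm_stepMatrix_apply (hA : ∀ i, A i i = 0) (hκ : 0 < κ)
    (hd : ∀ i, κ * modulusDegree A i < 1) (i j : Fin n) :
    ‖stepMatrix A κ i j‖ = absStepMatrix A κ i j := by
  rcases eq_or_ne i j with rfl | h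
  · rw [stepMatrix_apply_self hA, Complex.norm_of_nonneg (absStepMatrix_diag_pos hA hd i).le]
  · rw [stepMatrix_apply_ne h, absStepMatrix_apply_ne h, norm_mul, Complex.norm_of_nonneg hκ.le]

theorem stepMatrix_mul_of_isAligned (hA : ∀ i, A i i = 0) {ζ : Fin n → Circle}
    (hζ : IsAligned A ζ) (i j : Fin n) :
    stepMatrix A κ i j * ζ j = (absStepMatrix A κ i j : ℂ) * ζ i := by
  rcases eq_or_ne i j with rfl | h
  · rw [stepMatrix_apply_self hA]
  · rw [stepMatrix_apply_ne h, absStepMatrix_apply_ne h, mul_assoc, hζ i j]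
    push_cast
    ring

/-- In the coordinates given by an aligned gauge, trajectories are driven by the real matrix. -/
theorem IsTrajectory.gauge (hA : ∀ i, A i i = 0) {ζ : Fin n → Circle} (hζ : IsAligned A ζ)
    {z : ℕ → Fin n → ℂ} (hz : IsTrajectory A κ z) (k : ℕ) (i : Fin n) :
    (ζ i : ℂ)⁻¹ * z (k + 1) i = ∑ j, absStepMatrix A κ i j • ((ζ j : ℂ)⁻¹ * z k j) := by
  rw [isTrajectory_iff.1 hz k, Matrix.mulVec, dotProduct, Finset.mul_sum]
  refine Finset.sum_congr rfl fun j _ => ?_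
  have h := stepMatrix_mul_of_isAligned (κ := κ) hA hζ i j
  rw [Complex.real_smul, ← mul_right_inj' (Circle.coe_ne_zero (ζ i)),
    ← mul_right_inj' (Circle.coe_ne_zero (ζ j))]
  have hi := Circle.coe_ne_zero (ζ i)
  have hj := Circle.coe_ne_zero (ζ j)
  field_simp
  linear_combination z k j * h

/-- The left null vectors of the switched Laplacian are the stationary vectors of the real
iteration matrix. -/
theorem isNormalizedLeftNullVector_iff (hA : ∀ i, A i i = 0) (hκ : 0 < κ) {ζ : Fin n → Circle}
    (hζ : IsAligned A ζ) {ν : Fin n → ℝ} :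
    IsNormalizedLeftNullVector A ζ ν ↔ (∀ i, 0 ≤ ν i) ∧ ∑ i, ν i = 1 ∧
      ∀ j, ∑ i, ν i * absStepMatrix A κ i j = ν j := by
  -- Switching turns `κL` into `1 - P`, so left null vectors of one are left fixed vectors of the
  -- other.
  have hentry : ∀ i j, (κ : ℂ) * ((circleDiag ζ)⁻¹ * laplacian A * circleDiag ζ) i j =
      ((if i = j then 1 else 0) - absStepMatrix A κ i j : ℝ) := by
    intro i j
    have h := stepMatrix_mul_of_isAligned (κ := κ) hA hζ i j
    have hi := Circle.coe_ne_zero (ζ i)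
    rw [circleDiag_conj_apply]
    simp only [stepMatrix, Matrix.sub_apply, Matrix.smul_apply, smul_eq_mul, Matrix.one_apply] at h
    rw [← mul_right_inj' hi]
    have hcancel : (ζ i : ℂ) * (κ * ((ζ i : ℂ)⁻¹ * laplacian A i j * ζ j)) =
        κ * laplacian A i j * ζ j := by
      field_simp
    rw [hcancel]
    rcases eq_or_ne i j with rfl | hij
    · simp only [if_true] at h ⊢
      push_cast
      linear_combination -h
    · simp only [hij, if_false] at h ⊢
      push_cast
      linear_combination -h
  have hcol : ∀ j, (κ : ℂ) * Matrix.vecMul (fun i => (ν i : ℂ))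
      ((circleDiag ζ)⁻¹ * laplacian A * circleDiag ζ) j =
      (ν j - ∑ i, ν i * absStepMatrix A κ i j : ℝ) := by
    intro j
    rw [Matrix.vecMul, dotProduct, Finset.mul_sum]
    simp only [mul_left_comm (κ : ℂ), hentry, ← Complex.ofReal_mul, ← Complex.ofReal_sum, mul_sub,
      Finset.sum_sub_distrib, mul_ite, mul_one, mul_zero, Finset.sum_ite_eq', Finset.mem_univ,
      if_true]
  rw [IsNormalizedLeftNullVector]
  refine and_congr_right fun hν => ?_
  simp only [fun i => abs_of_nonneg (hν i)]
  refine and_congr_right fun _ => ?_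
  rw [funext_iff]
  refine forall_congr' fun j => ?_
  have hκ' : (κ : ℂ) ≠ 0 := Complex.ofReal_ne_zero.2 hκ.ne'
  rw [Pi.zero_apply, ← mul_right_inj' hκ', hcol, mul_zero, Complex.ofReal_eq_zero, sub_eq_zero,
    eq_comm]

end Iteration

/-! ### Convergence -/

section Convergence

variable {n : ℕ} {A : Matrix (Fin n) (Fin n) ℂ} {κ : ℝ}

theorem leftVector_dotProduct_circle {ζ : Fin n → Circle} {ν : Fin n → ℝ} (hν : ∑ i, ν i = 1) :
    leftVector ζ ν ⬝ᵥ (fun i => (ζ i : ℂ)) = 1 := by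
  have : ∀ i, leftVector ζ ν i * ζ i = ν i := fun i => by
    rw [leftVector_apply]
    field_simp [Circle.coe_ne_zero]
  simp only [dotProduct, this, ← Complex.ofReal_sum, hν, Complex.ofReal_one]

theorem IsTrajectory.tendsto (hA : ∀ i, A i i = 0) (hκ : 0 < κ)
    (hd : ∀ i, κ * modulusDegree A i < 1) (htree : HasSpanningTree (graph A))
    {ζ : Fin n → Circle} (hζ : IsAligned A ζ) {ν : Fin n → ℝ}
    (hν : IsNormalizedLeftNullVector A ζ ν) {z : ℕ → Fin n → ℂ} (hz : IsTrajectory A κ z) :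
    Tendsto z atTop (𝓝 ((leftVector ζ ν ⬝ᵥ z 0) • (fun i => (ζ i : ℂ)))) := by
  obtain ⟨r, hr⟩ := htree
  obtain ⟨-, hν1, hνP⟩ := (isNormalizedLeftNullVector_iff hA hκ hζ).1 hν
  rw [tendsto_pi_nhds]
  intro i
  have h := (tendsto_stationary (absStepMatrix_mem hκ hd) (absStepMatrix_diag_pos hA hd)
    (fun v => Relation.ReflTransGen.mono
      (fun _ _ h => absStepMatrix_pos_of_adj hA hκ h) r v (hr v))
    (y := fun k i => (ζ i : ℂ)⁻¹ * z k i) (fun k i => hz.gauge hA hζ k i) hν1 hνP i).mul_const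
    (ζ i : ℂ)
  convert h using 1
  · funext k
    field_simp [Circle.coe_ne_zero]
  · rw [Pi.smul_apply, smul_eq_mul, dotProduct]
    congr 2
    refine Finset.sum_congr rfl fun j _ => ?_
    rw [leftVector_apply, Complex.real_smul]
    ring

theorem exists_isNormalizedLeftNullVector [NeZero n] (hA : ∀ i, A i i = 0) (hκ : 0 < κ)
    (hd : ∀ i, κ * modulusDegree A i < 1) {ζ : Fin n → Circle} (hζ : IsAligned A ζ) :
    ∃ ν, IsNormalizedLeftNullVector A ζ ν := by
  obtain ⟨ν, hν⟩ := exists_stationary (absStepMatrix_mem hκ hd)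
  exact ⟨ν, (isNormalizedLeftNullVector_iff hA hκ hζ).2 hν⟩

/-- The kernel of `η` is a real subspace missing `ζ`, hence proper and Lebesgue null. -/
theorem ae_dotProduct_ne_zero {η ζ : Fin n → ℂ} (h : η ⬝ᵥ ζ = 1) :
    ∀ᵐ z : Fin n → ℂ, η ⬝ᵥ z ≠ 0 := by
  let f : (Fin n → ℂ) →ₗ[ℝ] ℂ :=
    { toFun := fun z => η ⬝ᵥ z
      map_add' := fun x y => dotProduct_add η x y
      map_smul' := fun c x => dotProduct_smul c η x }
  have hne : LinearMap.ker f ≠ ⊤ := by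
    intro htop
    have : ζ ∈ LinearMap.ker f := htop ▸ Submodule.mem_top
    exact one_ne_zero (h.symm.trans this)
  have := Measure.addHaar_submodule volume (LinearMap.ker f) hne
  rw [ae_iff]
  convert this using 2
  ext z
  simp [f]

theorem reachesComplexConsensus_of_isAligned [NeZero n] (hA : ∀ i, A i i = 0) (hκ : 0 < κ)
    (hd : ∀ i, κ * modulusDegree A i < 1) (htree : HasSpanningTree (graph A))
    {ζ : Fin n → Circle} (hζ : IsAligned A ζ) : ReachesComplexConsensus A κ := by
  obtain ⟨ν, hν⟩ := exists_isNormalizedLeftNullVector hA hκ hd hζ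
  have h1 := leftVector_dotProduct_circle (ζ := ζ)
    ((isNormalizedLeftNullVector_iff hA hκ hζ).1 hν).2.1
  filter_upwards [ae_dotProduct_ne_zero h1] with z₀ hz₀ z hz hzz
  subst hzz
  refine ⟨‖leftVector ζ ν ⬝ᵥ z 0‖, norm_pos_iff.2 hz₀, fun i => ?_⟩
  simpa [Circle.norm_coe] using ((tendsto_pi_nhds.1 (hz.tendsto hA hκ hd htree hζ hν)) i).norm

end Convergence

/-! ### Necessity -/

section Necessity

variable {n : ℕ} {A : Matrix (Fin n) (Fin n) ℂ} {κ : ℝ}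

/-- A vector with entries of equal positive modulus, mapped by the iteration matrix to another
one with the same modulus, yields an aligned gauge. -/
theorem exists_isAligned_of_norm_eq (hA : ∀ i, A i i = 0) (hκ : 0 < κ)
    (hd : ∀ i, κ * modulusDegree A i < 1) {a : ℝ} (ha : 0 < a) {w : Fin n → ℂ}
    (hw : ∀ i, ‖w i‖ = a) (hw' : ∀ i, ‖(stepMatrix A κ).mulVec w i‖ = a) :
    ∃ ζ, IsAligned A ζ := by
  have ha' : (a : ℂ) ≠ 0 := Complex.ofReal_ne_zero.2 ha.ne'
  have hP := absStepMatrix_mem hκ hd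
  have key : ∀ i j, stepMatrix A κ i j * w j = absStepMatrix A κ i j * w i := by
    intro i
    set u := (stepMatrix A κ).mulVec w i with hu
    have huu : u * starRingEnd ℂ u = a * a := by
      rw [Complex.mul_conj, Complex.normSq_eq_norm_sq, hw' i]
      push_cast
      ring
    have hnorm : ∀ j, ‖stepMatrix A κ i j * w j * starRingEnd ℂ u‖ =
        absStepMatrix A κ i j * (a * a) := fun j => by
      rw [norm_mul, norm_mul, norm_stepMatrix_apply hA hκ hd, hw, RCLike.norm_conj, hw', mul_assoc]
    -- These terms sum to `|u|² = a²`, and so do their moduli; each term therefore equals its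
    -- modulus.
    have hterm : ∀ j, stepMatrix A κ i j * w j * starRingEnd ℂ u =
        absStepMatrix A κ i j * (a * a) := by
      intro j
      have := eq_norm_of_sum_eq_sum_norm
        (t := fun j => stepMatrix A κ i j * w j * starRingEnd ℂ u) ?_ j
      · simp only [hnorm] at this
        exact_mod_cast this
      · simp only [hnorm]
        rw [← Finset.sum_mul, ← Finset.sum_mul, Matrix.sum_row_of_mem_rowStochastic hP, one_mul]
        exact_mod_cast huu
    have hmul : ∀ j, stepMatrix A κ i j * w j = absStepMatrix A κ i j * u := fun j => by
      have : (a * a : ℂ) * (stepMatrix A κ i j * w j) = a * a * (absStepMatrix A κ i j * u) := by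
        linear_combination u * hterm j - stepMatrix A κ i j * w j * huu
      exact mul_left_cancel₀ (mul_ne_zero ha' ha') this
    have hwu : w i = u := by
      have := hmul i
      rw [stepMatrix_apply_self hA] at this
      exact mul_left_cancel₀
        (Complex.ofReal_ne_zero.2 (absStepMatrix_diag_pos hA hd i).ne') this
    rw [hwu]
    exact hmul
  have hcirc : ∀ i, w i / a ∈ Submonoid.unitSphere ℂ := fun i => by
    refine mem_sphere_zero_iff_norm.2 ?_
    rw [norm_div, hw, Complex.norm_of_nonneg ha.le, div_self ha.ne']
  refine ⟨fun i => ⟨w i / a, hcirc i⟩, fun i j => ?_⟩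
  change A i j * (w j / a) = ‖A i j‖ * (w i / a)
  rcases eq_or_ne i j with rfl | h
  · simp [hA]
  · have hk := key i j
    rw [stepMatrix_apply_ne h, absStepMatrix_apply_ne h] at hk
    have : A i j * w j = ‖A i j‖ * w i := by
      refine mul_left_cancel₀ (Complex.ofReal_ne_zero.2 hκ.ne') ?_
      push_cast at hk
      linear_combination hk
    rw [← mul_div_assoc, this, mul_div_assoc]

/-- Only moduli are known to converge, so compactness supplies a limit point; a single good initial
state suffices. -/
theorem ReachesComplexConsensus.exists_isAligned (hA : ∀ i, A i i = 0) (hκ : 0 < κ)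
    (hd : ∀ i, κ * modulusDegree A i < 1) (h : ReachesComplexConsensus A κ) :
    ∃ ζ, IsAligned A ζ := by
  obtain ⟨z₀, hz₀⟩ := h.exists
  obtain ⟨z, hz, hzz⟩ := exists_isTrajectory A κ z₀
  obtain ⟨a, ha, hlim⟩ := hz₀ z hz hzz
  have hbdd : ∀ᶠ k in atTop, z k ∈ Metric.closedBall (0 : Fin n → ℂ) (a + 1) := by
    filter_upwards [eventually_all.2 fun i => (hlim i).eventually_lt_const (lt_add_one a)]
      with k hk
    rw [mem_closedBall_zero_iff, pi_norm_le_iff_of_nonneg (by linarith)]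
    exact fun i => (hk i).le
  obtain ⟨w, -, φ, hφ, hw⟩ :=
    tendsto_subseq_of_frequently_bounded Metric.isBounded_closedBall hbdd.frequently
  have hw' : Tendsto (fun k => z (φ k + 1)) atTop (𝓝 ((stepMatrix A κ).mulVec w)) := by
    simp only [isTrajectory_iff.1 hz]
    have hc : Continuous fun x => (stepMatrix A κ).mulVec x := by fun_prop
    exact (hc.tendsto w).comp hw
  refine exists_isAligned_of_norm_eq hA hκ hd ha (w := w) (fun i => ?_) fun i => ?_
  · exact tendsto_nhds_unique ((tendsto_pi_nhds.1 hw i).norm)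
      ((hlim i).comp hφ.tendsto_atTop)
  · exact tendsto_nhds_unique ((tendsto_pi_nhds.1 hw' i).norm)
      ((hlim i).comp ((tendsto_add_atTop_nat 1).comp hφ.tendsto_atTop))

theorem ReachesComplexConsensus.hasSpanningTree [NeZero n] (hA : ∀ i, A i i = 0) (hκ : 0 < κ)
    (hd : ∀ i, κ * modulusDegree A i < 1) (h : ReachesComplexConsensus A κ) {ζ : Fin n → Circle}
    (hζ : IsAligned A ζ) : HasSpanningTree (graph A) := by
  classical
  by_contra hno
  obtain ⟨v, w, hvw⟩ := exists_disjoint_ancestors hno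
  have hclosed : ∀ x i, Relation.ReflTransGen (graph A).Adj i x → ∀ j,
      absStepMatrix A κ i j ≠ 0 → Relation.ReflTransGen (graph A).Adj j x := by
    intro x i hi j hij
    rcases eq_or_ne i j with rfl | hne
    · exact hi
    · rw [absStepMatrix_apply_ne hne] at hij
      exact .head (norm_ne_zero_iff.1 (right_ne_zero_of_mul hij)) hi
  -- a state with gauged values `1` at the ancestors of `v` and `2` elsewhere
  let c : Fin n → ℂ := fun i => if Relation.ReflTransGen (graph A).Adj i v then 1 else 2
  -- A set of full measure is dense, so it meets the ball. The radius `1/4` is small enough that no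
  -- `a` is within it of both `1` and `2`.
  obtain ⟨z₀, hz₀, hball⟩ : ∃ z₀, (∀ z, IsTrajectory A κ z → z 0 = z₀ →
      ∃ a : ℝ, 0 < a ∧ ∀ i, Tendsto (fun k => ‖z k i‖) atTop (𝓝 a)) ∧
      z₀ ∈ Metric.ball (fun i => ζ i * c i) (1 / 4) :=
    (Measure.dense_of_ae h).exists_mem_open Metric.isOpen_ball
      ⟨_, Metric.mem_ball_self (by norm_num)⟩
  obtain ⟨z, hz, rfl⟩ := exists_isTrajectory A κ z₀
  obtain ⟨a, -, hlim⟩ := hz₀ z hz rfl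
  have hinit : ∀ i, ‖(ζ i : ℂ)⁻¹ * z 0 i - c i‖ ≤ 1 / 4 := by
    intro i
    have h1 : ‖z 0 i - ζ i * c i‖ ≤ 1 / 4 :=
      (norm_le_pi_norm (z 0 - fun i => ζ i * c i) i).trans
        (by simpa [dist_eq_norm] using (Metric.mem_ball.1 hball).le)
    have h2 : (ζ i : ℂ)⁻¹ * z 0 i - c i = (ζ i : ℂ)⁻¹ * (z 0 i - ζ i * c i) := by
      field_simp [Circle.coe_ne_zero]
    rw [h2, norm_mul]
    simpa [Circle.norm_coe] using h1
  -- The ancestors of `x` receive no input from outside, so their gauged values never leave the ball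
  -- about `b`.
  have hnear : ∀ x (b : ℂ), (∀ i, Relation.ReflTransGen (graph A).Adj i x → c i = b) →
      |a - ‖b‖| ≤ 1 / 4 := by
    intro x b hb
    have hk : ∀ k, |‖z k x‖ - ‖b‖| ≤ 1 / 4 := by
      intro k
      have := norm_sub_le_of_predecessor_closed (absStepMatrix_mem hκ hd)
        (S := {i | Relation.ReflTransGen (graph A).Adj i x}) (hclosed x)
        (y := fun k i => (ζ i : ℂ)⁻¹ * z k i) (fun k i => hz.gauge hA hζ k i)
        (c := b) (fun i hi => hb i hi ▸ hinit i) k x .refl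
      simpa [Circle.norm_coe] using (abs_norm_sub_norm_le _ _).trans this
    exact le_of_tendsto (((hlim x).sub_const ‖b‖).abs) (Eventually.of_forall hk)
  have hv := hnear v 1 fun i hi => if_pos hi
  have hw := hnear w 2 fun i hi => if_neg fun hi' => hvw i hi' hi
  rw [norm_one, abs_le] at hv
  rw [Complex.norm_two, abs_le] at hw
  linarith [hv.2, hw.1]

end Necessity

end ComplexConsensus

theorem mainTheorem2 {n : ℕ} [NeZero n] (A : Matrix (Fin n) (Fin n) ℂ) (hA : ∀ i, A i i = 0)
    (κ : ℝ) (hκ : 0 < κ)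
    -- `κ < 1 / Δ`, where `1 / Δ` is read as `+∞` if `Δ = 0`
    (hκΔ : ComplexConsensus.maxModulusDegree A ≠ 0 →
      κ < 1 / ComplexConsensus.maxModulusDegree A) :
    (ComplexConsensus.ReachesComplexConsensus A κ ↔
      ComplexConsensus.EssentiallyNonnegative A ∧
        ComplexConsensus.HasSpanningTree (ComplexConsensus.graph A)) ∧
    (ComplexConsensus.EssentiallyNonnegative A →
      ComplexConsensus.HasSpanningTree (ComplexConsensus.graph A) →
      (∃ (ζ : Fin n → Circle) (ν : Fin n → ℝ),
        ComplexConsensus.IsCircleNullVector A ζ ∧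
        ComplexConsensus.IsNormalizedLeftNullVector A ζ ν) ∧
      ∀ (ζ : Fin n → Circle) (ν : Fin n → ℝ),
        ComplexConsensus.IsCircleNullVector A ζ →
        ComplexConsensus.IsNormalizedLeftNullVector A ζ ν →
        ∀ z : ℕ → Fin n → ℂ, ComplexConsensus.IsTrajectory A κ z →
          Tendsto z atTop
            (𝓝 ((ComplexConsensus.leftVector ζ ν ⬝ᵥ z 0) • (fun i => (ζ i : ℂ))))) := by
  have hd := ComplexConsensus.mul_modulusDegree_lt_one hκ hκΔ
  refine ⟨⟨fun h => ?_, fun ⟨hess, htree⟩ => ?_⟩, fun hess htree => ⟨?_, ?_⟩⟩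
  · obtain ⟨ζ, hζ⟩ := h.exists_isAligned hA hκ hd
    exact ⟨ComplexConsensus.essentiallyNonnegative_iff_exists_isAligned.2 ⟨ζ, hζ⟩,
      h.hasSpanningTree hA hκ hd hζ⟩
  · obtain ⟨ζ, hζ⟩ := ComplexConsensus.essentiallyNonnegative_iff_exists_isAligned.1 hess
    exact ComplexConsensus.reachesComplexConsensus_of_isAligned hA hκ hd htree hζ
  · obtain ⟨ζ, hζ⟩ := ComplexConsensus.essentiallyNonnegative_iff_exists_isAligned.1 hess
    obtain ⟨ν, hν⟩ := ComplexConsensus.exists_isNormalizedLeftNullVector hA hκ hd hζ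
    exact ⟨ζ, ν, ComplexConsensus.isCircleNullVector_iff_isAligned.2 hζ, hν⟩
  · intro ζ ν hζ hν z hz
    exact hz.tendsto hA hκ hd htree (ComplexConsensus.isCircleNullVector_iff_isAligned.1 hζ) hν
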